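/- Let $\mathcal H_1$ and $\mathcal H_2$ be complex Hilbert spaces with $\mathcal H_2\neq\{0\}$, let $\mathcal H_1\otimes\mathcal H_2$ be their Hilbert space tensor product, and let $\mathcal B(\mathcal H)$ denote the bounded linear operators on $\mathcal H$ with the operator norm. Then there is a completely positive linear map $\mathbb E:\mathcal B(\mathcal H_1\otimes\mathcal H_2)\to\mathcal B(\mathcal H_1)$ with the following properties: 1. For all $A\in\mathcal B(\mathcal H_1)$, $\mathbb E(A\otimes \mathbb 1)=A$. 2. For every real $\epsilon$, whenever $A\in\mathcal B(\mathcal H_1\otimes\mathcal H_2)$ satisfies $\|[A,\mathbb 1\otimes B]\|\le\epsilon\,\|A\|\,\|B\|$ for all $B\in\mathcal B(\mathcal H_2)$, where $[X,Y]=XY-YX$, one has $\|\mathbb E(A)\otimes\mathbb 1-A\|\le\epsilon\,\|A\|$. 3. For all $C,D\in\mathcal B(\mathcal H_1)$ and $A\in\mathcal B(\mathcal H_1\otimes\mathcal H_2)$, $\mathbb E\big((C\otimes\mathbb 1)\,A\,(D\otimes\mathbb 1)\big)=C\,\mathbb E(A)\,D$. -/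

import Mathlib

open scoped TensorProduct CStarAlgebra

noncomputable section

/-- The Hilbert space tensor product of two Hilbert spaces: the completion of the algebraic tensor
product for the inner product with `⟪a ⊗ b, c ⊗ d⟫ = ⟪a, c⟫ * ⟪b, d⟫`. -/
abbrev HilbertTensor (H₁ H₂ : Type*)
    [NormedAddCommGroup H₁] [InnerProductSpace ℂ H₁]
    [NormedAddCommGroup H₂] [InnerProductSpace ℂ H₂] : Type _ :=
  UniformSpace.Completion (H₁ ⊗[ℂ] H₂)

variable {H₁ H₂ : Type*}
  [NormedAddCommGroup H₁] [InnerProductSpace ℂ H₁]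
  [NormedAddCommGroup H₂] [InnerProductSpace ℂ H₂]

/-- The bounded operator `A ⊗ B` on the Hilbert space tensor product: the continuous extension of
the algebraic tensor product of `A` and `B`. -/
def opTensor (A : H₁ →L[ℂ] H₁) (B : H₂ →L[ℂ] H₂) :
    HilbertTensor H₁ H₂ →L[ℂ] HilbertTensor H₁ H₂ :=
  (TensorProduct.mapL A B).completion

/-- `A ⊗ B` acts on elementary tensors by `(A ⊗ B) (x ⊗ y) = A x ⊗ B y`. -/
theorem opTensor_tmul (A : H₁ →L[ℂ] H₁) (B : H₂ →L[ℂ] H₂) (x : H₁) (y : H₂) :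
    opTensor A B ((x ⊗ₜ[ℂ] y : H₁ ⊗[ℂ] H₂) : HilbertTensor H₁ H₂) =
      ((A x ⊗ₜ[ℂ] B y : H₁ ⊗[ℂ] H₂) : HilbertTensor H₁ H₂) := by
  simp [opTensor]

end

/-! Fix a Hilbert basis `b` of `H₂` and write `V_k x = x ⊗ b k`. For a finite index set `s`, the
normalized partial trace `E_s(A) = |s|⁻¹ ∑_{k ∈ s} V_k* A V_k` is a contraction with nonnegative
matrix forms, is a bimodule map over `H₁`-operators, and fixes `A ⊗ 1` once `s` is nonempty. `E` is
its weak limit along an ultrafilter finer than `atTop`; linearity, positivity and the identities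
pass to the limit.

For the commutator estimate, signed permutations of `b` on `s` extend to isometries `T` of `H₂`.
Averaging `⟨Uφ, A Uψ⟩`, `U = 1 ⊗ T`, over this finite group gives the form of `E_s(A) ⊗ 1` exactly,
for `φ, ψ` supported on `s` (`card_mul_sum_signed_perm`). Each term differs from `⟨φ, Aψ⟩` by at
most `ε ‖A‖ ‖φ‖ ‖ψ‖`, hence so does the average. The limit over `s` and density of finite sums
finish the bound. -/

open Filter Topology ContinuousLinearMap in
/-- A bounded net of operators on a Hilbert space converges in the weak operator topology along any
ultrafilter. -/
theorem Ultrafilter.exists_tendsto_inner {α H : Type*} [NormedAddCommGroup H]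
    [InnerProductSpace ℂ H] [CompleteSpace H] (𝒰 : Ultrafilter α) (T : α → H →L[ℂ] H) (C : ℝ)
    (hT : ∀ a, ‖T a‖ ≤ C) :
    ∃ S : H →L[ℂ] H, ∀ x y, Tendsto (fun a => inner ℂ x (T a y)) 𝒰 (𝓝 (inner ℂ x (S y))) := by
  have hb : ∀ x y a, ‖inner ℂ x (T a y)‖ ≤ C * ‖x‖ * ‖y‖ := fun x y a =>
    calc _ ≤ ‖x‖ * ‖T a y‖ := norm_inner_le_norm _ _
      _ ≤ ‖x‖ * (C * ‖y‖) := by gcongr; exact (T a).le_of_opNorm_le (hT a) y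
      _ = _ := by ring
  have key : ∀ x y, ∃ z : ℂ, ‖z‖ ≤ C * ‖x‖ * ‖y‖ ∧
      Tendsto (fun a => inner ℂ x (T a y)) 𝒰 (𝓝 z) := by
    intro x y
    obtain ⟨z, hz, h⟩ := (isCompact_closedBall (0 : ℂ) (C * ‖x‖ * ‖y‖)).ultrafilter_le_nhds
      (𝒰.map fun a => inner ℂ x (T a y))
      (le_principal_iff.2 <| mem_map.2 <| univ_mem' fun a => by simpa using hb x y a)
    exact ⟨z, by simpa using hz, h⟩
  choose l hl hlim using key
  let B : H →ₗ⋆[ℂ] H →ₗ[ℂ] ℂ := LinearMap.mk₂'ₛₗ (starRingEnd ℂ) (RingHom.id ℂ) l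
    (fun x x' y => tendsto_nhds_unique (hlim _ _)
      (by simpa [inner_add_left] using (hlim x y).add (hlim x' y)))
    (fun c x y => tendsto_nhds_unique (hlim _ _)
      (by simpa [inner_smul_left, mul_comm] using (hlim x y).const_mul ((starRingEnd ℂ) c)))
    (fun x y y' => tendsto_nhds_unique (hlim _ _)
      (by simpa [inner_add_right] using (hlim x y).add (hlim x y')))
    (fun c x y => tendsto_nhds_unique (hlim _ _)
      (by simpa [inner_smul_right] using (hlim x y).const_mul c))
  -- Riesz representation puts the operator in the first slot of the inner product; the adjoint
  -- moves it to the second.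
  refine ⟨adjoint (InnerProductSpace.continuousLinearMapOfBilin (B.mkContinuous₂ C hl)),
    fun x y => ?_⟩
  rw [adjoint_inner_right, InnerProductSpace.continuousLinearMapOfBilin_apply]
  exact hlim x y

/-! ### Positivity of operator matrices -/

/-- The witness is the negative part `a⁻`, which is orthogonal to `a⁺`. -/
theorem CStarAlgebra.exists_nonneg_mul_eq_neg_mul_self {A : Type*} [NonUnitalCStarAlgebra A]
    [PartialOrder A] [StarOrderedRing A] {a : A} (ha : IsSelfAdjoint a) :
    ∃ r : A, 0 ≤ r ∧ a * r = -(r * r) ∧ (r = 0 → 0 ≤ a) := by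
  refine ⟨a⁻, CFC.negPart_nonneg a, ?_, (CFC.negPart_eq_zero_iff a).1⟩
  have h : a * a⁻ = (a⁺ - a⁻) * a⁻ := by rw [CFC.posPart_sub_negPart a ha]
  rw [h, sub_mul, CFC.posPart_mul_negPart, zero_sub]

theorem CStarAlgebra.exists_eq_star_mul_self {A : Type*} [NonUnitalCStarAlgebra A]
    [PartialOrder A] [StarOrderedRing A] {a : A} (ha : 0 ≤ a) : ∃ b : A, a = star b * b :=
  CStarAlgebra.nonneg_iff_eq_star_mul_self.1 ha

open ContinuousLinearMap in
theorem CStarMatrix.inner_star_mul_self_apply {n H : Type*} [Fintype n] [NormedAddCommGroup H]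
    [InnerProductSpace ℂ H] [CompleteSpace H] (N : CStarMatrix n n (H →L[ℂ] H)) (i j : n)
    (x y : H) : inner ℂ x ((star N * N) i j y) = ∑ k, inner ℂ (N k i x) (N k j y) := by
  rw [CStarMatrix.mul_apply, sum_apply, inner_sum]
  refine Finset.sum_congr rfl fun k _ => ?_
  rw [CStarMatrix.star_apply, star_eq_adjoint, mul_apply_eq_comp, adjoint_inner_right]

open scoped ComplexOrder in
theorem inner_self_nonneg_complex {H : Type*} [NormedAddCommGroup H] [InnerProductSpace ℂ H]
    (x : H) : (0 : ℂ) ≤ inner ℂ x x := by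
  rw [inner_self_eq_norm_sq_to_K, ← RCLike.ofReal_pow]
  exact RCLike.ofReal_nonneg.2 (sq_nonneg ‖x‖)

open scoped ComplexOrder in
/-- The quadratic form of a positive operator matrix is nonnegative. -/
theorem CStarMatrix.sum_inner_nonneg {n H : Type*} [Fintype n] [NormedAddCommGroup H]
    [InnerProductSpace ℂ H] [CompleteSpace H] {M : CStarMatrix n n (H →L[ℂ] H)} (hM : 0 ≤ M)
    (x : n → H) : 0 ≤ ∑ i, ∑ j, inner ℂ (x i) (M i j (x j)) := by
  obtain ⟨N, rfl⟩ := CStarAlgebra.exists_eq_star_mul_self hM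
  have : ∑ i, ∑ j, inner ℂ (x i) ((star N * N) i j (x j)) =
      ∑ k, inner ℂ (∑ i, N k i (x i)) (∑ i, N k i (x i)) := by
    simp only [inner_star_mul_self_apply, inner_sum, sum_inner]
    rw [Finset.sum_comm_cycle]
    exact Finset.sum_congr rfl fun k _ => Finset.sum_comm
  rw [this]
  exact Finset.sum_nonneg fun k _ => inner_self_nonneg_complex _

open scoped ComplexOrder in
open ContinuousLinearMap in
/-- A self-adjoint operator matrix whose quadratic form is nonnegative is positive. -/
theorem CStarMatrix.nonneg_of_sum_inner_nonneg {n H : Type*} [Fintype n]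
    [NormedAddCommGroup H] [InnerProductSpace ℂ H] [CompleteSpace H]
    {M : CStarMatrix n n (H →L[ℂ] H)} (hsa : IsSelfAdjoint M)
    (hM : ∀ x : n → H, 0 ≤ ∑ i, ∑ j, inner ℂ (x i) (M i j (x j))) : 0 ≤ M := by
  obtain ⟨R, hR0, hMR, hR⟩ := CStarAlgebra.exists_nonneg_mul_eq_neg_mul_self hsa
  apply hR
  have hRs : star R = R := (IsSelfAdjoint.of_nonneg hR0).star_eq
  obtain ⟨Q, hQ⟩ := CStarAlgebra.exists_eq_star_mul_self hR0
  -- With `R = M⁻ = Q*Q`, this is `R M R = -R³ = -(QR)*(QR)`. Its diagonal entries are forms of `M`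
  -- on columns of `R`, hence nonnegative, which forces `QR = 0` and then `R = 0`.
  have hRM : star R * (M * R) = -(star (Q * R) * (Q * R)) := by
    have h : R * (R * R) = star (Q * R) * (Q * R) := by
      rw [star_mul, hRs, mul_assoc, ← mul_assoc (star Q), ← hQ]
    rw [hRs, hMR, mul_neg, h]
  have hform : ∀ (i : n) (x : H), 0 ≤ inner ℂ x ((star R * (M * R)) i i x) := by
    intro i x
    convert hM fun j => R j i x using 1
    rw [CStarMatrix.mul_apply, sum_apply, inner_sum]
    refine Finset.sum_congr rfl fun k _ => ?_
    rw [CStarMatrix.star_apply, star_eq_adjoint, mul_apply_eq_comp, adjoint_inner_right,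
      CStarMatrix.mul_apply, sum_apply, inner_sum]
    rfl
  have hQR : Q * R = 0 := by
    ext i j x
    have h : 0 ≤ -inner ℂ x ((star (Q * R) * (Q * R)) j j x) := by
      have h := hform j x
      rw [hRM] at h
      rw [← inner_neg_right]
      exact h
    rw [neg_nonneg, inner_star_mul_self_apply] at h
    have h2 := (Finset.sum_eq_zero_iff_of_nonneg
      fun k _ => inner_self_nonneg_complex ((Q * R) k j x)).1
      (le_antisymm h (Finset.sum_nonneg fun k _ => inner_self_nonneg_complex _)) i
      (Finset.mem_univ i)
    exact inner_self_eq_zero.1 h2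
  have : star R * R = 0 := by
    nth_rw 1 [hRs, hQ]
    rw [mul_assoc, hQR, mul_zero]
  exact (CStarRing.star_mul_self_eq_zero_iff R).1 this

/-! ### Averages over signed permutations -/

section Averaging

variable {κ : Type*} [Fintype κ] [DecidableEq κ]

/-- For `i ≠ j`, `χ ↦ χ i * χ j` is a nontrivial character of the sign group, so it sums to zero. -/
theorem sum_signs_mul (i j : κ) :
    ∑ χ : κ → ℤˣ, (((χ i : ℤ) : ℂ) * ((χ j : ℤ) : ℂ)) =
      if i = j then (Fintype.card (κ → ℤˣ) : ℂ) else 0 := by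
  split_ifs with h
  · subst h
    have : ∀ χ : κ → ℤˣ, (((χ i : ℤ) : ℂ) * ((χ i : ℤ) : ℂ)) = 1 := fun χ => by
      rw [← Int.cast_mul, ← Units.val_mul]; simp
    simp [this]
  · let f : (κ → ℤˣ) →* ℂ :=
      (Int.castRingHom ℂ : ℤ →* ℂ).comp ((Units.coeHom ℤ).comp
        (Pi.evalMonoidHom (fun _ : κ => ℤˣ) i * Pi.evalMonoidHom (fun _ : κ => ℤˣ) j))
    have hf : f ≠ 1 := fun h1 => by
      have := DFunLike.congr_fun h1 (Function.update (1 : κ → ℤˣ) i (-1))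
      simp [f, Function.update_of_ne (Ne.symm h)] at this
      norm_num at this
    simpa [f] using sum_hom_units_eq_zero f hf

/-- The inner sum is independent of `i`, by right translation with a swap; summing it over all `i`
counts each value of `f` once per permutation. -/
theorem card_mul_sum_perm (i : κ) (f : κ → ℂ) :
    (Fintype.card κ : ℂ) * ∑ σ : Equiv.Perm κ, f (σ i) =
      (Fintype.card (Equiv.Perm κ) : ℂ) * ∑ k, f k := by
  have h : ∀ j, ∑ σ : Equiv.Perm κ, f (σ j) = ∑ σ : Equiv.Perm κ, f (σ i) := fun j =>
    Fintype.sum_equiv (Equiv.mulRight (Equiv.swap i j)) _ _ fun σ => by simp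
  calc _ = ∑ j : κ, ∑ σ : Equiv.Perm κ, f (σ j) := by simp [h]
    _ = ∑ σ : Equiv.Perm κ, ∑ j, f (σ j) := Finset.sum_comm
    _ = _ := by simp [Equiv.sum_comp]

/-- Averaging a four-index array over all signed permutations. -/
theorem card_mul_sum_signed_perm (c : κ → κ → κ → κ → ℂ) :
    (Fintype.card κ : ℂ) * ∑ g : Equiv.Perm κ × (κ → ℤˣ),
        ∑ i, ∑ j, ((g.2 i : ℤ) : ℂ) * ((g.2 j : ℤ) : ℂ) * c i (g.1 i) j (g.1 j) =
      (Fintype.card (Equiv.Perm κ × (κ → ℤˣ)) : ℂ) * ∑ i, ∑ k, c i k i k := by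
  -- The signs kill the terms with `i ≠ j`; the permutations then make `σ i` uniform.
  have h : ∑ g : Equiv.Perm κ × (κ → ℤˣ),
        ∑ i, ∑ j, ((g.2 i : ℤ) : ℂ) * ((g.2 j : ℤ) : ℂ) * c i (g.1 i) j (g.1 j) =
      (Fintype.card (κ → ℤˣ) : ℂ) * ∑ i, ∑ σ : Equiv.Perm κ, c i (σ i) i (σ i) := by
    rw [Fintype.sum_prod_type, Finset.sum_comm (s := Finset.univ (α := κ)), Finset.mul_sum]
    refine Finset.sum_congr rfl fun σ _ => ?_
    rw [Finset.sum_comm, Finset.mul_sum]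
    refine Finset.sum_congr rfl fun i _ => ?_
    rw [Finset.sum_comm]
    simp_rw [← Finset.sum_mul, sum_signs_mul]
    simp [Finset.sum_ite_eq]
  have h' : (Fintype.card κ : ℂ) * ∑ i, ∑ σ : Equiv.Perm κ, c i (σ i) i (σ i) =
      (Fintype.card (Equiv.Perm κ) : ℂ) * ∑ i, ∑ k, c i k i k := by
    rw [Finset.mul_sum, Finset.mul_sum]
    exact Finset.sum_congr rfl fun i _ => card_mul_sum_perm i fun k => c i k i k
  rw [h, Fintype.card_prod, Nat.cast_mul, mul_left_comm, h']
  ring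

end Averaging

/-! ### Elementary tensors and operators on one factor -/

section TensorRight

variable {H₁ H₂ : Type*} [NormedAddCommGroup H₁] [InnerProductSpace ℂ H₁]
  [NormedAddCommGroup H₂] [InnerProductSpace ℂ H₂]

/-- The bounded map `x ↦ x ⊗ e` into the Hilbert space tensor product. -/
noncomputable def tensorRight (H₁ : Type*) [NormedAddCommGroup H₁] [InnerProductSpace ℂ H₁]
    (e : H₂) : H₁ →L[ℂ] HilbertTensor H₁ H₂ :=
  (UniformSpace.Completion.toComplL (𝕜 := ℂ) (E := H₁ ⊗[ℂ] H₂)).comp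
    ((TensorProduct.mkL ℂ H₁ H₂).flip e)

theorem tensorRight_apply (e : H₂) (x : H₁) :
    tensorRight H₁ e x = ((x ⊗ₜ[ℂ] e : H₁ ⊗[ℂ] H₂) : HilbertTensor H₁ H₂) := rfl

theorem inner_tensorRight (e f : H₂) (x y : H₁) :
    inner ℂ (tensorRight H₁ e x) (tensorRight H₁ f y) = inner ℂ x y * inner ℂ e f := by
  simp [tensorRight_apply, UniformSpace.Completion.inner_coe]

theorem norm_tensorRight_apply (e : H₂) (x : H₁) : ‖tensorRight H₁ e x‖ = ‖x‖ * ‖e‖ := by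
  simp [tensorRight_apply, UniformSpace.Completion.norm_coe]

theorem opTensor_tensorRight (A : H₁ →L[ℂ] H₁) (B : H₂ →L[ℂ] H₂) (e : H₂) (x : H₁) :
    opTensor A B (tensorRight H₁ e x) = tensorRight H₁ (B e) (A x) :=
  opTensor_tmul A B x e

theorem tensorRight_smul (c : ℂ) (e : H₂) (x : H₁) :
    tensorRight H₁ (c • e) x = c • tensorRight H₁ e x := by
  rw [tensorRight_apply, TensorProduct.tmul_smul, UniformSpace.Completion.coe_smul]; rfl

/-- A closed subspace of the Hilbert space tensor product containing the elementary tensors is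
everything. -/
theorem topologicalClosure_eq_top_of_tensorRight_mem
    (W : Submodule ℂ (HilbertTensor H₁ H₂))
    (h : ∀ e x, tensorRight H₁ e x ∈ W.topologicalClosure) : W.topologicalClosure = ⊤ := by
  refine (Submodule.eq_top_iff').2 fun φ => ?_
  induction φ using UniformSpace.Completion.induction_on with
  | hp => exact W.isClosed_topologicalClosure
  | ih t =>
    induction t using TensorProduct.induction_on with
    | zero => rw [UniformSpace.Completion.coe_zero]; exact zero_mem _
    | tmul x e => exact h e x
    | add s t hs ht => rw [UniformSpace.Completion.coe_add]; exact add_mem hs ht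

theorem dense_span_tensorRight :
    (Submodule.span ℂ {φ | ∃ e x, tensorRight (H₂ := H₂) H₁ e x = φ}).topologicalClosure = ⊤ :=
  topologicalClosure_eq_top_of_tensorRight_mem _ fun e x =>
    Submodule.le_topologicalClosure _ (Submodule.subset_span ⟨e, x, rfl⟩)

theorem hilbertTensor_ext {F : Type*} [NormedAddCommGroup F] [NormedSpace ℂ F]
    {S T : HilbertTensor H₁ H₂ →L[ℂ] F}
    (h : ∀ e x, S (tensorRight H₁ e x) = T (tensorRight H₁ e x)) : S = T :=
  ContinuousLinearMap.ext_on
    ((Submodule.dense_iff_topologicalClosure_eq_top).2 dense_span_tensorRight)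
    (by rintro _ ⟨e, x, rfl⟩; exact h e x)

theorem norm_opTensor_one_isometry (T : H₂ →ₗᵢ[ℂ] H₂) (φ : HilbertTensor H₁ H₂) :
    ‖opTensor (1 : H₁ →L[ℂ] H₁) T.toContinuousLinearMap φ‖ = ‖φ‖ := by
  induction φ using UniformSpace.Completion.induction_on with
  | hp => exact isClosed_eq (by fun_prop) (by fun_prop)
  | ih t =>
    simp only [opTensor, ContinuousLinearMap.completion_apply_coe,
      UniformSpace.Completion.norm_coe]
    have h := (TensorProduct.mapIsometry (LinearIsometry.id (R := ℂ) (E := H₁)) T).norm_map t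
    rwa [← LinearIsometry.coe_toContinuousLinearMap,
      TensorProduct.toContinuousLinearMap_mapIsometry] at h

theorem inner_opTensor_one_isometry (T : H₂ →ₗᵢ[ℂ] H₂) (φ ψ : HilbertTensor H₁ H₂) :
    inner ℂ (opTensor (1 : H₁ →L[ℂ] H₁) T.toContinuousLinearMap φ)
      (opTensor (1 : H₁ →L[ℂ] H₁) T.toContinuousLinearMap ψ) = inner ℂ φ ψ :=
  LinearMap.norm_map_iff_inner_map_map
    (opTensor (1 : H₁ →L[ℂ] H₁) T.toContinuousLinearMap) |>.1 (norm_opTensor_one_isometry T) φ ψ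

theorem adjoint_tensorRight_tensorRight [CompleteSpace H₁] (e f : H₂) (x : H₁) :
    ContinuousLinearMap.adjoint (tensorRight H₁ e) (tensorRight H₁ f x) = inner ℂ e f • x :=
  ext_inner_left ℂ fun y => by
    rw [ContinuousLinearMap.adjoint_inner_right, inner_tensorRight, inner_smul_right, mul_comm]

/-- Source of the bimodule property of the partial traces. -/
theorem adjoint_tensorRight_opTensor [CompleteSpace H₁] (e : H₂) (C : H₁ →L[ℂ] H₁)
    (φ : HilbertTensor H₁ H₂) :
    ContinuousLinearMap.adjoint (tensorRight H₁ e) (opTensor C (1 : H₂ →L[ℂ] H₂) φ) =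
      C (ContinuousLinearMap.adjoint (tensorRight H₁ e) φ) := by
  have h : (ContinuousLinearMap.adjoint (tensorRight H₁ e)).comp
      (opTensor C (1 : H₂ →L[ℂ] H₂)) =
      C.comp (ContinuousLinearMap.adjoint (tensorRight H₁ e)) :=
    hilbertTensor_ext fun f x => by
      simp [opTensor_tensorRight, adjoint_tensorRight_tensorRight]
  exact DFunLike.congr_fun h φ

theorem norm_tensorRight_le {e : H₂} (he : ‖e‖ = 1) : ‖tensorRight H₁ e‖ ≤ 1 :=
  ContinuousLinearMap.opNorm_le_bound _ zero_le_one fun x => by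
    rw [norm_tensorRight_apply, he, mul_one, one_mul]

end TensorRight

/-! ### Hilbert bases of the second factor -/

section Basis

variable {H₁ H₂ ι : Type*} [NormedAddCommGroup H₁] [InnerProductSpace ℂ H₁]
  [NormedAddCommGroup H₂] [InnerProductSpace ℂ H₂]

theorem dense_iSup_range_tensorRight (b : HilbertBasis ι ℂ H₂) :
    Dense ((⨆ i, LinearMap.range (tensorRight H₁ (b i)).toLinearMap :
      Submodule ℂ (HilbertTensor H₁ H₂)) : Set (HilbertTensor H₁ H₂)) := by
  refine (Submodule.dense_iff_topologicalClosure_eq_top).2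
    (topologicalClosure_eq_top_of_tensorRight_mem _ fun e x => ?_)
  set W := ⨆ i, LinearMap.range (tensorRight H₁ (b i)).toLinearMap
  -- For fixed `x`, the map `e ↦ x ⊗ e` is continuous, so a closed subspace containing every `x ⊗ b
  -- i` contains every `x ⊗ e`.
  let L : H₂ →L[ℂ] HilbertTensor H₁ H₂ :=
    (UniformSpace.Completion.toComplL (𝕜 := ℂ) (E := H₁ ⊗[ℂ] H₂)).comp
      (TensorProduct.mkL ℂ H₁ H₂ x)
  have h : (Submodule.span ℂ (Set.range b)).topologicalClosure ≤
      W.topologicalClosure.comap L.toLinearMap := by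
    refine Submodule.topologicalClosure_minimal _ (Submodule.span_le.2 ?_)
      (W.isClosed_topologicalClosure.preimage L.continuous)
    rintro _ ⟨i, rfl⟩
    exact W.le_topologicalClosure (Submodule.mem_iSup_of_mem i ⟨x, rfl⟩)
  rw [b.dense_span] at h
  exact h (Submodule.mem_top (x := e))

theorem exists_sum_tensorRight (b : HilbertBasis ι ℂ H₂) {φ : HilbertTensor H₁ H₂}
    (h : φ ∈ ⨆ i, LinearMap.range (tensorRight H₁ (b i)).toLinearMap) :
    ∃ f : ι →₀ H₁, φ = f.sum fun i x => tensorRight H₁ (b i) x := by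
  classical
  induction h using Submodule.iSup_induction' with
  | mem i x hx =>
    obtain ⟨y, rfl⟩ := hx
    exact ⟨Finsupp.single i y, by simp⟩
  | zero => exact ⟨0, by simp⟩
  | add x y _ _ hx hy =>
    obtain ⟨f, rfl⟩ := hx
    obtain ⟨g, rfl⟩ := hy
    exact ⟨f + g, by rw [Finsupp.sum_add_index'] <;> simp⟩

/-- A permutation of a Hilbert basis with phases extends to an isometry. -/
theorem HilbertBasis.exists_isometry_signed_perm [CompleteSpace H₂] (b : HilbertBasis ι ℂ H₂)
    {τ : ι → ι} (hτ : Function.Injective τ) (c : ι → ℂ) (hc : ∀ i, ‖c i‖ = 1) :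
    ∃ T : H₂ →ₗᵢ[ℂ] H₂, ∀ i, T (b i) = c i • b (τ i) := by
  classical
  have hv : Orthonormal ℂ fun i => c i • b (τ i) := by
    rw [orthonormal_iff_ite]
    intro i j
    have hb := orthonormal_iff_ite.1 b.orthonormal (τ i) (τ j)
    rw [inner_smul_left, inner_smul_right, hb]
    by_cases h : i = j
    · subst h
      simp [← Complex.normSq_eq_conj_mul_self, Complex.normSq_eq_norm_sq, hc]
    · simp [h, hτ.ne h]
  refine ⟨hv.orthogonalFamily.linearIsometry.comp b.repr.toLinearIsometry, fun i => ?_⟩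
  change hv.orthogonalFamily.linearIsometry (b.repr (b i)) = _
  rw [b.repr_self, OrthogonalFamily.linearIsometry_apply_single]
  simp

end Basis

/-! ### Normalized partial traces -/

section NormalizedTrace

variable {H₁ H₂ ι : Type*} [NormedAddCommGroup H₁] [InnerProductSpace ℂ H₁] [CompleteSpace H₁]
  [NormedAddCommGroup H₂] [InnerProductSpace ℂ H₂]

open ContinuousLinearMap in
/-- The normalized partial trace over the span of finitely many vectors of a Hilbert basis. -/
noncomputable def partialTrace (b : HilbertBasis ι ℂ H₂) (s : Finset ι)
    (A : HilbertTensor H₁ H₂ →L[ℂ] HilbertTensor H₁ H₂) : H₁ →L[ℂ] H₁ :=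
  (s.card : ℂ)⁻¹ • ∑ k ∈ s,
    (adjoint (tensorRight H₁ (b k))).comp (A.comp (tensorRight H₁ (b k)))

theorem inner_partialTrace (b : HilbertBasis ι ℂ H₂) (s : Finset ι)
    (A : HilbertTensor H₁ H₂ →L[ℂ] HilbertTensor H₁ H₂) (x y : H₁) :
    inner ℂ x (partialTrace b s A y) = (s.card : ℂ)⁻¹ *
      ∑ k ∈ s, inner ℂ (tensorRight H₁ (b k) x) (A (tensorRight H₁ (b k) y)) := by
  simp [partialTrace, ContinuousLinearMap.adjoint_inner_right]

theorem partialTrace_add (b : HilbertBasis ι ℂ H₂) (s : Finset ι)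
    (A B : HilbertTensor H₁ H₂ →L[ℂ] HilbertTensor H₁ H₂) :
    partialTrace b s (A + B) = partialTrace b s A + partialTrace b s B := by
  simp [partialTrace, Finset.sum_add_distrib]

theorem partialTrace_smul (b : HilbertBasis ι ℂ H₂) (s : Finset ι) (c : ℂ)
    (A : HilbertTensor H₁ H₂ →L[ℂ] HilbertTensor H₁ H₂) :
    partialTrace b s (c • A) = c • partialTrace b s A := by
  simp [partialTrace, ← Finset.smul_sum, smul_comm c]

open ContinuousLinearMap in
theorem partialTrace_adjoint (b : HilbertBasis ι ℂ H₂) (s : Finset ι)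
    (A : HilbertTensor H₁ H₂ →L[ℂ] HilbertTensor H₁ H₂) :
    partialTrace b s (star A) = star (partialTrace b s A) := by
  simp [partialTrace, star_eq_adjoint, adjoint_comp, comp_assoc]

theorem partialTrace_opTensor_mul_mul (b : HilbertBasis ι ℂ H₂) (s : Finset ι)
    (C D : H₁ →L[ℂ] H₁) (A : HilbertTensor H₁ H₂ →L[ℂ] HilbertTensor H₁ H₂) :
    partialTrace b s (opTensor C (1 : H₂ →L[ℂ] H₂) * A * opTensor D (1 : H₂ →L[ℂ] H₂)) =
      C * partialTrace b s A * D := by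
  ext x
  simp [partialTrace, opTensor_tensorRight,
    adjoint_tensorRight_opTensor]

theorem partialTrace_opTensor_one (b : HilbertBasis ι ℂ H₂) {s : Finset ι} (hs : s.Nonempty)
    (A : H₁ →L[ℂ] H₁) : partialTrace b s (opTensor A (1 : H₂ →L[ℂ] H₂)) = A := by
  have h : (s.card : ℂ) ≠ 0 := by simpa using hs.ne_empty
  ext x
  simp [partialTrace, opTensor_tensorRight,
    adjoint_tensorRight_tensorRight, b.orthonormal.1, ← Nat.cast_smul_eq_nsmul ℂ, smul_smul, h]

open ContinuousLinearMap in
theorem norm_partialTrace_le (b : HilbertBasis ι ℂ H₂) (s : Finset ι)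
    (A : HilbertTensor H₁ H₂ →L[ℂ] HilbertTensor H₁ H₂) : ‖partialTrace b s A‖ ≤ ‖A‖ := by
  have h : ‖∑ k ∈ s, (adjoint (tensorRight H₁ (b k))).comp
      (A.comp (tensorRight H₁ (b k)))‖ ≤ s.card * ‖A‖ := by
    rw [← nsmul_eq_mul]
    refine (norm_sum_le_of_le (f := fun k => (adjoint (tensorRight H₁ (b k))).comp
      (A.comp (tensorRight H₁ (b k)))) (n := fun _ => ‖A‖) s (fun k _ => ?_)).trans (by simp)
    have h1 := norm_tensorRight_le (H₁ := H₁) (b.orthonormal.1 k)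
    calc _ ≤ ‖adjoint (tensorRight H₁ (b k))‖ * (‖A‖ * ‖tensorRight H₁ (b k)‖) := by
          grw [opNorm_comp_le, opNorm_comp_le]
      _ ≤ 1 * (‖A‖ * 1) := by
          rw [LinearIsometryEquiv.norm_map]
          gcongr
      _ = ‖A‖ := by ring
  rw [partialTrace, norm_smul, norm_inv, Complex.norm_natCast]
  grw [h]
  -- For empty `s` the convention `0⁻¹ = 0` makes the partial trace zero.
  rcases s.eq_empty_or_nonempty with rfl | hs
  · simp
    exact norm_nonneg A
  · rw [← mul_assoc, inv_mul_cancel₀ (by simpa using hs.ne_empty), one_mul]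

-- Each `k` contributes the form of `M` at the vectors `x i ⊗ b k`.
open scoped ComplexOrder in
theorem sum_inner_partialTrace_nonneg {n : Type*} [Fintype n] (b : HilbertBasis ι ℂ H₂)
    (s : Finset ι)
    {M : CStarMatrix n n (HilbertTensor H₁ H₂ →L[ℂ] HilbertTensor H₁ H₂)} (hM : 0 ≤ M)
    (x : n → H₁) : 0 ≤ ∑ i, ∑ j, inner ℂ (x i) (partialTrace b s (M i j) (x j)) := by
  have h : ∑ i, ∑ j, inner ℂ (x i) (partialTrace b s (M i j) (x j)) = (s.card : ℂ)⁻¹ *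
      ∑ k ∈ s, ∑ i, ∑ j,
        inner ℂ (tensorRight H₁ (b k) (x i)) (M i j (tensorRight H₁ (b k) (x j))) := by
    simp only [inner_partialTrace, ← Finset.mul_sum]
    rw [Finset.sum_comm_cycle]
  rw [h]
  exact mul_nonneg (inv_nonneg.2 (Nat.cast_nonneg _)) (Finset.sum_nonneg fun k _ =>
    CStarMatrix.sum_inner_nonneg hM fun i => tensorRight H₁ (b k) (x i))

end NormalizedTrace

/-! ### From commutators to partial traces -/

section Commutator

theorem norm_inv_card_mul_sum_sub_le {G : Type*} [Fintype G] [Nonempty G] (a : G → ℂ) (z : ℂ)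
    (M : ℝ) (h : ∀ g, ‖a g - z‖ ≤ M) : ‖(Fintype.card G : ℂ)⁻¹ * ∑ g, a g - z‖ ≤ M := by
  have hG : (Fintype.card G : ℂ) ≠ 0 := Nat.cast_ne_zero.2 Fintype.card_ne_zero
  have hG' : (Fintype.card G : ℝ) ≠ 0 := Nat.cast_ne_zero.2 Fintype.card_ne_zero
  have : (Fintype.card G : ℂ)⁻¹ * ∑ g, a g - z = (Fintype.card G : ℂ)⁻¹ * ∑ g, (a g - z) := by
    rw [Finset.sum_sub_distrib, mul_sub]
    simp [hG]
  rw [this, norm_mul, norm_inv, Complex.norm_natCast]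
  calc _ ≤ (Fintype.card G : ℝ)⁻¹ * (Fintype.card G * M) := by
        gcongr
        exact (norm_sum_le_of_le _ fun g _ => h g).trans (by simp)
    _ = M := by rw [← mul_assoc, inv_mul_cancel₀ hG', one_mul]

variable {H₁ H₂ ι : Type*} [NormedAddCommGroup H₁] [InnerProductSpace ℂ H₁]
  [NormedAddCommGroup H₂] [InnerProductSpace ℂ H₂]

/-- Since `U = 1 ⊗ T` is isometric, `⟨φ, Aψ⟩ = ⟨Uφ, UAψ⟩`, so the difference is `⟨Uφ, [A, U]ψ⟩`. -/
theorem norm_inner_conj_sub_le {A : HilbertTensor H₁ H₂ →L[ℂ] HilbertTensor H₁ H₂} {δ : ℝ}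
    (T : H₂ →ₗᵢ[ℂ] H₂)
    (hT : ‖A * opTensor (1 : H₁ →L[ℂ] H₁) T.toContinuousLinearMap -
      opTensor (1 : H₁ →L[ℂ] H₁) T.toContinuousLinearMap * A‖ ≤ δ)
    (φ ψ : HilbertTensor H₁ H₂) :
    ‖inner ℂ (opTensor (1 : H₁ →L[ℂ] H₁) T.toContinuousLinearMap φ)
      (A (opTensor (1 : H₁ →L[ℂ] H₁) T.toContinuousLinearMap ψ)) - inner ℂ φ (A ψ)‖ ≤
      δ * ‖φ‖ * ‖ψ‖ := by
  set U := opTensor (1 : H₁ →L[ℂ] H₁) T.toContinuousLinearMap with hU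
  rw [← inner_opTensor_one_isometry T φ (A ψ), ← hU, ← inner_sub_right]
  calc _ ≤ ‖U φ‖ * ‖(A * U - U * A) ψ‖ := norm_inner_le_norm _ _
    _ ≤ ‖φ‖ * (δ * ‖ψ‖) := by
        rw [hU, norm_opTensor_one_isometry T φ]
        gcongr
        exact ContinuousLinearMap.le_of_opNorm_le _ hT ψ
    _ = _ := by ring

theorem HilbertBasis.exists_isometry_signed_perm_finset [CompleteSpace H₂]
    (b : HilbertBasis ι ℂ H₂) (s : Finset ι) (σ : Equiv.Perm s) (χ : s → ℤˣ) :
    ∃ T : H₂ →ₗᵢ[ℂ] H₂, ∀ i : s, T (b i) = ((χ i : ℤ) : ℂ) • b (σ i) := by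
  classical
  have hn : ∀ u : ℤˣ, ‖((u : ℤ) : ℂ)‖ = 1 := fun u => by
    rcases Int.units_eq_one_or u with rfl | rfl <;> simp
  -- Basis vectors outside `s` are left fixed.
  obtain ⟨T, hT⟩ := b.exists_isometry_signed_perm (Equiv.Perm.ofSubtype σ).injective
    (fun i => if h : i ∈ s then ((χ ⟨i, h⟩ : ℤ) : ℂ) else 1)
    (fun i => by split_ifs <;> first | exact hn _ | exact norm_one)
  exact ⟨T, fun i => by simp [hT]⟩

/-- If `A` almost commutes with all isometries of the second factor, then its normalized partial
traces almost agree with `A` on finite sums of elementary tensors. -/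
theorem norm_sum_inner_partialTrace_sub_le [CompleteSpace H₁] [CompleteSpace H₂]
    (b : HilbertBasis ι ℂ H₂)
    {A : HilbertTensor H₁ H₂ →L[ℂ] HilbertTensor H₁ H₂} {δ : ℝ}
    (hA : ∀ T : H₂ →ₗᵢ[ℂ] H₂, ‖A * opTensor (1 : H₁ →L[ℂ] H₁) T.toContinuousLinearMap -
      opTensor (1 : H₁ →L[ℂ] H₁) T.toContinuousLinearMap * A‖ ≤ δ)
    {s : Finset ι} (hs : s.Nonempty) (f g : s → H₁) :
    ‖∑ i, inner ℂ (f i) (partialTrace b s A (g i)) -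
      inner ℂ (∑ i : s, tensorRight H₁ (b i) (f i)) (A (∑ i : s, tensorRight H₁ (b i) (g i)))‖ ≤
      δ * ‖∑ i : s, tensorRight H₁ (b i) (f i)‖ * ‖∑ i : s, tensorRight H₁ (b i) (g i)‖ := by
  classical
  set φ := ∑ i : s, tensorRight H₁ (b i) (f i) with hφ
  set ψ := ∑ i : s, tensorRight H₁ (b i) (g i) with hψ
  choose T hT using fun p : Equiv.Perm s × (s → ℤˣ) =>
    b.exists_isometry_signed_perm_finset s p.1 p.2
  let U := fun p => opTensor (1 : H₁ →L[ℂ] H₁) (T p).toContinuousLinearMap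
  have hU : ∀ p (h : s → H₁), U p (∑ i : s, tensorRight H₁ (b i) (h i)) =
      ∑ i, ((p.2 i : ℤ) : ℂ) • tensorRight H₁ (b (p.1 i)) (h i) := fun p h => by
    simp only [U, map_sum, opTensor_tensorRight, LinearIsometry.coe_toContinuousLinearMap, hT,
      tensorRight_smul, one_apply_eq_self]
  have hsum := card_mul_sum_signed_perm fun i k j l : s =>
    inner ℂ (tensorRight H₁ (b k) (f i)) (A (tensorRight H₁ (b l) (g j)))
  have hterm : ∀ p : Equiv.Perm s × (s → ℤˣ), inner ℂ (U p φ) (A (U p ψ)) =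
      ∑ i, ∑ j, ((p.2 i : ℤ) : ℂ) * ((p.2 j : ℤ) : ℂ) *
        inner ℂ (tensorRight H₁ (b (p.1 i)) (f i)) (A (tensorRight H₁ (b (p.1 j)) (g j))) :=
    fun p => by
      simp only [hφ, hψ, hU, map_sum, map_smul, sum_inner, inner_sum, inner_smul_left,
        inner_smul_right, map_intCast, Finset.mul_sum]
      rw [Finset.sum_comm]
      exact Finset.sum_congr rfl fun i _ => Finset.sum_congr rfl fun j _ => by ring
  -- The partial trace appears as an exact group average; the factor `|s|⁻¹` comes from the
  -- equidistribution of `σ i`.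
  have hmain : ∑ i, inner ℂ (f i) (partialTrace b s A (g i)) =
      (Fintype.card (Equiv.Perm s × (s → ℤˣ)) : ℂ)⁻¹ * ∑ p, inner ℂ (U p φ) (A (U p ψ)) := by
    have hs0 : (s.card : ℂ) ≠ 0 := by simpa using hs.ne_empty
    have hG : (Fintype.card (Equiv.Perm s × (s → ℤˣ)) : ℂ) ≠ 0 :=
      Nat.cast_ne_zero.2 Fintype.card_ne_zero
    simp_rw [hterm, inner_partialTrace, ← Finset.mul_sum]
    rw [Fintype.card_coe] at hsum
    rw [inv_mul_eq_div, inv_mul_eq_div, div_eq_div_iff hs0 hG,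
      mul_comm (Finset.sum _ _) (s.card : ℂ), hsum, mul_comm]
    congr 1
    exact Finset.sum_congr rfl fun i _ => (Finset.sum_coe_sort s fun k =>
      inner ℂ (tensorRight H₁ (b k) (f i)) (A (tensorRight H₁ (b k) (g i)))).symm
  rw [hmain]
  exact norm_inv_card_mul_sum_sub_le _ _ _ fun p => norm_inner_conj_sub_le (T p) (hA _) φ ψ

end Commutator

/-- The bound extends to all vectors by continuity; then take `φ = T ψ`. -/
theorem ContinuousLinearMap.opNorm_le_of_inner_le_of_dense {H : Type*} [NormedAddCommGroup H]
    [InnerProductSpace ℂ H] (T : H →L[ℂ] H) {C : ℝ} (hC : 0 ≤ C) {W : Set H} (hW : Dense W)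
    (h : ∀ φ ∈ W, ∀ ψ ∈ W, ‖inner ℂ φ (T ψ)‖ ≤ C * ‖φ‖ * ‖ψ‖) : ‖T‖ ≤ C := by
  have h' : ∀ φ ψ, ‖inner ℂ φ (T ψ)‖ ≤ C * ‖φ‖ * ‖ψ‖ := by
    have hcl : IsClosed {p : H × H | ‖inner ℂ p.1 (T p.2)‖ ≤ C * ‖p.1‖ * ‖p.2‖} :=
      isClosed_le (by fun_prop) (by fun_prop)
    intro φ ψ
    have hsub : W ×ˢ W ⊆ {p : H × H | ‖inner ℂ p.1 (T p.2)‖ ≤ C * ‖p.1‖ * ‖p.2‖} :=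
      fun p hp => h p.1 hp.1 p.2 hp.2
    exact closure_minimal hsub hcl ((hW.prod hW) (φ, ψ))
  refine T.opNorm_le_bound hC fun ψ => ?_
  rcases (norm_nonneg (T ψ)).eq_or_lt with h0 | h0
  · rw [← h0]; positivity
  · have := h' (T ψ) ψ
    rw [inner_self_eq_norm_sq_to_K, norm_pow, RCLike.norm_ofReal, abs_norm] at this
    nlinarith

theorem CStarMatrix.star_eq_of_nonneg {n H : Type*} [Fintype n] [NormedAddCommGroup H]
    [InnerProductSpace ℂ H] [CompleteSpace H] {M : CStarMatrix n n (H →L[ℂ] H)} (hM : 0 ≤ M) :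
    star M = M :=
  (IsSelfAdjoint.of_nonneg hM).star_eq

theorem Finsupp.sum_eq_sum_coe_of_support_subset {ι M N : Type*} [Zero M] [AddCommMonoid N]
    (f : ι →₀ M) {s : Finset ι} (hs : f.support ⊆ s) (h : ι → M → N) (h0 : ∀ i, h i 0 = 0) :
    f.sum h = ∑ i : s, h i (f i) := by
  rw [Finsupp.sum_of_support_subset f hs h fun i _ => h0 i,
    Finset.sum_coe_sort s fun i => h i (f i)]

/-! ### The weak limit and its properties -/

section ConditionalExpectation

variable {H₁ H₂ ι : Type*} [NormedAddCommGroup H₁] [InnerProductSpace ℂ H₁] [CompleteSpace H₁]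
  [NormedAddCommGroup H₂] [InnerProductSpace ℂ H₂]

open Filter Topology ComplexOrder

/-- The weak limit of the normalized partial traces along an ultrafilter, as a completely positive
map. -/
theorem exists_completelyPositiveMap_tendsto_partialTrace (b : HilbertBasis ι ℂ H₂)
    (𝒰 : Ultrafilter (Finset ι)) :
    ∃ E : (HilbertTensor H₁ H₂ →L[ℂ] HilbertTensor H₁ H₂) →CP (H₁ →L[ℂ] H₁),
      ∀ A x y, Tendsto (fun s => inner ℂ x (partialTrace b s A y)) 𝒰 (𝓝 (inner ℂ x (E A y))) := by
  choose E hE using fun A : HilbertTensor H₁ H₂ →L[ℂ] HilbertTensor H₁ H₂ =>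
    𝒰.exists_tendsto_inner (fun s => partialTrace b s A) ‖A‖ fun s => norm_partialTrace_le b s A
  -- Uniqueness of weak limits transfers algebraic identities from the partial traces to `E`.
  have hext : ∀ {A} {S : H₁ →L[ℂ] H₁},
      (∀ x y, Tendsto (fun s => inner ℂ x (partialTrace b s A y)) 𝒰 (𝓝 (inner ℂ x (S y)))) →
      E A = S := fun h => ContinuousLinearMap.ext fun y => ext_inner_left ℂ fun x =>
    tendsto_nhds_unique (hE _ x y) (h x y)
  let L : (HilbertTensor H₁ H₂ →L[ℂ] HilbertTensor H₁ H₂) →ₗ[ℂ] (H₁ →L[ℂ] H₁) :=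
    { toFun := E
      map_add' := fun A B => hext fun x y => by
        simpa [partialTrace_add, inner_add_right] using (hE A x y).add (hE B x y)
      map_smul' := fun c A => hext fun x y => by
        simpa [partialTrace_smul, inner_smul_right] using (hE A x y).const_mul c }
  have hstar : ∀ A, E (star A) = star (E A) := fun A => hext fun x y => by
    have h : ∀ F : H₁ →L[ℂ] H₁, inner ℂ x (star F y) = star (inner ℂ y (F x)) := fun F => by
      rw [ContinuousLinearMap.star_eq_adjoint, ContinuousLinearMap.adjoint_inner_right]
      exact (inner_conj_symm _ _).symm
    simp_rw [fun s => partialTrace_adjoint b s A, h]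
    exact (continuous_star.tendsto _).comp (hE A y x)
  refine ⟨⟨L, fun k M hM => CStarMatrix.nonneg_of_sum_inner_nonneg ?_ fun x => ?_⟩, hE⟩
  · have hMs : star M = M := CStarMatrix.star_eq_of_nonneg hM
    refine CStarMatrix.ext fun i j => ?_
    rw [CStarMatrix.star_apply, CStarMatrix.map_apply, CStarMatrix.map_apply]
    change star (E (M j i)) = E (M i j)
    rw [← hstar, ← CStarMatrix.star_apply, hMs]
  · have hlim : Tendsto (fun s => ∑ i, ∑ j, inner ℂ (x i) (partialTrace b s (M i j) (x j))) 𝒰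
        (𝓝 (∑ i, ∑ j, inner ℂ (x i) (E (M i j) (x j)))) :=
      tendsto_finsetSum _ fun i _ => tendsto_finsetSum _ fun j _ => hE _ _ _
    exact ge_of_tendsto hlim (Eventually.of_forall fun s => sum_inner_partialTrace_nonneg b s hM x)

/-- The commutator bound passes to the weak limit of the normalized partial traces. -/
theorem norm_opTensor_sub_le_of_tendsto_partialTrace [CompleteSpace H₂]
    (b : HilbertBasis ι ℂ H₂) [Nonempty ι]
    {𝒰 : Ultrafilter (Finset ι)} (h𝒰 : (𝒰 : Filter (Finset ι)) ≤ atTop)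
    {A : HilbertTensor H₁ H₂ →L[ℂ] HilbertTensor H₁ H₂} {S : H₁ →L[ℂ] H₁}
    (hS : ∀ x y, Tendsto (fun s => inner ℂ x (partialTrace b s A y)) 𝒰 (𝓝 (inner ℂ x (S y))))
    {δ : ℝ} (hδ : 0 ≤ δ)
    (hA : ∀ T : H₂ →ₗᵢ[ℂ] H₂, ‖A * opTensor (1 : H₁ →L[ℂ] H₁) T.toContinuousLinearMap -
      opTensor (1 : H₁ →L[ℂ] H₁) T.toContinuousLinearMap * A‖ ≤ δ) :
    ‖opTensor S (1 : H₂ →L[ℂ] H₂) - A‖ ≤ δ := by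
  classical
  refine ContinuousLinearMap.opNorm_le_of_inner_le_of_dense _ hδ
    (dense_iSup_range_tensorRight (H₁ := H₁) b) fun φ hφ ψ hψ => ?_
  obtain ⟨f, rfl⟩ := exists_sum_tensorRight b hφ
  obtain ⟨g, rfl⟩ := exists_sum_tensorRight b hψ
  obtain ⟨i₀⟩ := ‹Nonempty ι›
  -- Including `i₀` keeps every `s ⊇ s₀` nonempty even when both supports are empty.
  set s₀ := insert i₀ (f.support ∪ g.support)
  set φ := f.sum fun i x => tensorRight H₁ (b i) x with hφ
  set ψ := g.sum fun i x => tensorRight H₁ (b i) x with hψ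
  have hsum : ∀ s, s₀ ⊆ s →
      φ = ∑ i : s, tensorRight H₁ (b i) (f i) ∧ ψ = ∑ i : s, tensorRight H₁ (b i) (g i) :=
    fun s hs => ⟨
      f.sum_eq_sum_coe_of_support_subset
        (fun i hi => hs (by simp [s₀, Finsupp.mem_support_iff.1 hi])) _ (by simp),
      g.sum_eq_sum_coe_of_support_subset
        (fun i hi => hs (by simp [s₀, Finsupp.mem_support_iff.1 hi])) _ (by simp)⟩
  have hS' : inner ℂ φ (opTensor S (1 : H₂ →L[ℂ] H₂) ψ) = ∑ i : s₀, inner ℂ (f i) (S (g i)) := by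
    obtain ⟨h1, h2⟩ := hsum s₀ subset_rfl
    rw [h1, h2]
    simp only [map_sum, opTensor_tensorRight, sum_inner, inner_sum, inner_tensorRight,
      one_apply_eq_self, orthonormal_iff_ite.1 b.orthonormal, Subtype.coe_inj]
    simp
  have hlim : Tendsto (fun s => ∑ i : s₀, inner ℂ (f i) (partialTrace b s A (g i)) -
      inner ℂ φ (A ψ)) 𝒰 (𝓝 (∑ i : s₀, inner ℂ (f i) (S (g i)) - inner ℂ φ (A ψ))) :=
    (tendsto_finsetSum _ fun i _ => hS _ _).sub_const _
  rw [sub_apply, inner_sub_right, hS']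
  refine le_of_tendsto hlim.norm (h𝒰 (mem_atTop_sets.2 ⟨s₀, fun s hs => ?_⟩))
  have hext : ∑ i : s₀, inner ℂ (f i) (partialTrace b s A (g i)) =
      ∑ i : s, inner ℂ (f i) (partialTrace b s A (g i)) := by
    rw [Finset.sum_coe_sort s₀ fun i => inner ℂ (f i) (partialTrace b s A (g i)),
      Finset.sum_coe_sort s fun i => inner ℂ (f i) (partialTrace b s A (g i))]
    refine Finset.sum_subset hs fun i _ hi => ?_
    have : f i = 0 := by
      by_contra h
      exact hi (by simp [s₀, h])
    simp [this]
  have hmain := norm_sum_inner_partialTrace_sub_le b hA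
    (⟨i₀, hs (Finset.mem_insert_self _ _)⟩ : s.Nonempty) (fun i => f i) (fun i => g i)
  rw [← (hsum s hs).1, ← (hsum s hs).2, ← hext] at hmain
  exact hmain

end ConditionalExpectation

/-! ### The main theorem -/

theorem lemma1 {H₁ H₂ : Type*}
    [NormedAddCommGroup H₁] [InnerProductSpace ℂ H₁] [CompleteSpace H₁]
    [NormedAddCommGroup H₂] [InnerProductSpace ℂ H₂] [CompleteSpace H₂] [Nontrivial H₂] :
    ∃ E : (HilbertTensor H₁ H₂ →L[ℂ] HilbertTensor H₁ H₂) →CP (H₁ →L[ℂ] H₁),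
      (∀ A : H₁ →L[ℂ] H₁, E (opTensor A (1 : H₂ →L[ℂ] H₂)) = A) ∧
      (∀ (ε : ℝ) (A : HilbertTensor H₁ H₂ →L[ℂ] HilbertTensor H₁ H₂),
        (∀ B : H₂ →L[ℂ] H₂,
          ‖A * opTensor (1 : H₁ →L[ℂ] H₁) B - opTensor (1 : H₁ →L[ℂ] H₁) B * A‖
            ≤ ε * ‖A‖ * ‖B‖) →
          ‖opTensor (E A) (1 : H₂ →L[ℂ] H₂) - A‖ ≤ ε * ‖A‖) ∧
      (∀ (C D : H₁ →L[ℂ] H₁) (A : HilbertTensor H₁ H₂ →L[ℂ] HilbertTensor H₁ H₂),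
        E (opTensor C (1 : H₂ →L[ℂ] H₂) * A * opTensor D (1 : H₂ →L[ℂ] H₂)) = C * E A * D) := by
  obtain ⟨w, b, -⟩ := exists_hilbertBasis ℂ H₂
  have hw : Nonempty w := by
    by_contra h
    rw [not_nonempty_iff] at h
    have := b.dense_span
    rw [Set.range_eq_empty, Submodule.span_empty,
      IsClosed.submodule_topologicalClosure_eq (by simp)] at this
    exact bot_ne_top this
  let 𝒰 : Ultrafilter (Finset w) := Ultrafilter.of Filter.atTop
  have h𝒰 : (𝒰 : Filter (Finset w)) ≤ Filter.atTop := Ultrafilter.of_le _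
  obtain ⟨E, hE⟩ := exists_completelyPositiveMap_tendsto_partialTrace (H₁ := H₁) b 𝒰
  refine ⟨E, fun A => ?_, fun ε A hA => ?_, fun C D A => ?_⟩
  · refine ContinuousLinearMap.ext fun y => ext_inner_left ℂ fun x =>
      tendsto_nhds_unique (hE _ x y) (tendsto_const_nhds.congr' ?_)
    filter_upwards [h𝒰 (Filter.eventually_ge_atTop {hw.some})] with s hs
    rw [partialTrace_opTensor_one b ⟨hw.some, hs (Finset.mem_singleton_self _)⟩]
  -- No sign is assumed for `ε`: testing with `B = 1`, of norm one as `H₂` is nontrivial, gives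
  -- nonnegativity.
  · have hδ : 0 ≤ ε * ‖A‖ := by
      have h : 0 ≤ ε * ‖A‖ * ‖(1 : H₂ →L[ℂ] H₂)‖ :=
        le_trans (ContinuousLinearMap.opNorm_nonneg _) (hA 1)
      rwa [norm_one, mul_one] at h
    refine norm_opTensor_sub_le_of_tendsto_partialTrace b h𝒰 (hE A) hδ fun T => ?_
    exact (hA _).trans (mul_le_of_le_one_right hδ T.norm_toContinuousLinearMap_le)
  · refine ContinuousLinearMap.ext fun y => ext_inner_left ℂ fun x =>
      tendsto_nhds_unique (hE _ x y) ?_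
    have h : ∀ F : H₁ →L[ℂ] H₁, inner ℂ x ((C * F * D) y) =
        inner ℂ (ContinuousLinearMap.adjoint C x) (F (D y)) := fun F => by
      rw [ContinuousLinearMap.adjoint_inner_left]
      rfl
    simp_rw [partialTrace_opTensor_mul_mul, h]
    exact hE A _ _
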